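/- \textbf{Setting.} Let $u_k' = f_k(u) := r^P_k(u)-r^D_k(u)+\sum_{\nu=1}^d (p_{k\nu}(u)-d_{k\nu}(u))$, $k=1,\dots,d$, be an autonomous production-destruction-rest system with $p_{k\nu}=d_{\nu k}$, $p_{kk}=0$, whose rates $r^P_k,r^D_k,p_{k\nu}$ are nonnegative and $C^1$ on $\mathbb R^d_{>0}$. Let $u$ be a solution on $[t_n,t_n+T]$, $T>0$, with values in $\mathbb R^d_{>0}$, and put $u^n=u(t_n)$. An MPRK step from $u^n$ with step size $\Delta t>0$ is based on an explicit Runge--Kutta method with nonnegative coefficients $a_{ij}$, $b_j$ and on positive Patankar-weight denominators $\pi^{(i)}_\nu$, $\sigma_\nu$ (which may depend on $\Delta t$; the $\pi^{(i)}_\nu$ stay bounded away from $0$ as $\Delta t\to0$). Its stages $u^{(i)}$ and its update $u^{n+1}$ satisfy $$u^{(i)}_k=u^n_k+\Delta t\sum_{j<i}a_{ij}\Bigl(r^P_k(u^{(j)})+\sum_\nu p_{k\nu}(u^{(j)})\tfrac{u^{(i)}_\nu}{\pi^{(i)}_\nu}-\bigl(r^D_k(u^{(j)})+\sum_\nu d_{k\nu}(u^{(j)})\bigr)\tfrac{u^{(i)}_k}{\pi^{(i)}_k}\Bigr),$$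 $$u^{n+1}_k=u^n_k+\Delta t\sum_{j}b_j\Bigl(r^P_k(u^{(j)})+\sum_\nu p_{k\nu}(u^{(j)})\tfrac{u^{n+1}_\nu}{\sigma_\nu}-\bigl(r^D_k(u^{(j)})+\sum_\nu d_{k\nu}(u^{(j)})\bigr)\tfrac{u^{n+1}_k}{\sigma_k}\Bigr).$$ It is of order $p$ if $u^{n+1}=u(t_n+\Delta t)+O(\Delta t^{p+1})$ as $\Delta t\to0^+$. Let $V\subseteq\mathbb R$ be a neighbourhood of $1$. A relaxed dense output of the step is a family $u^{n+\gamma}$, $\gamma\in V$, satisfying the equation for $u^{n+1}$ with $b_j$ replaced by $\bar b_j(\gamma)=\gamma b_j$ and $\sigma$ replaced by positive denominators $\bar\sigma(\gamma)$, where $\bar\sigma(1)=\sigma$ (so that $\gamma=1$ is the original step). All equations are required for all sufficiently small $\Delta t>0$, and all $O(\cdot)$ are for $\Delta t\to0^+$. For $p\ge1$ consider the condition $$\bar\sigma(\gamma)=u(t_n+\Delta t)+(\gamma-1)\bigl(u(t_n+\Delta t)-u(t_n)\bigr)+O(\Delta t^p).\qquad(E_p)$$ \textbf{(a)} Let the MPRK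 step be of order $p\ge1$, and let $(E_p)$ hold for all $\gamma\in V$. Then for all $\gamma\in V$ and $\nu=1,\dots,d$, $$\frac{u^{n+\gamma}_\nu}{\bar\sigma_\nu(\gamma)}=1+O(\Delta t^p)=\frac{u^{n+1}_\nu}{\sigma_\nu}+O(\Delta t^p),\qquad u^{n+\gamma}=u^{n+1}+(\gamma-1)(u^{n+1}-u^n)+O(\Delta t^{p+1}).$$ If $(E_p)$ holds uniformly for $\gamma$ in a bounded set $W\subseteq V$, then the conclusions hold uniformly for $\gamma\in W$. \textbf{(b)} (Bootstrap to arbitrary order.) Let $1\le m\le P$ be arbitrary integers and, for $q=m,\dots,P$, let an MPRK step from $u^n$ of order $q$ with a relaxed dense output $u_q^{n+\gamma}$, $\gamma\in V$, with denominators $\bar\sigma_q(\gamma)$ be given, such that $\bar\sigma_{q+1}(\gamma)=u_q^{n+\gamma}$ for $m\le q<P$, $\gamma\in V$ and all sufficiently small $\Delta t$ (uniformly in $\gamma$). If $\bar\sigma_m$ satisfies $(E_m)$ for all $\gamma\in V$, then for every $q=m,\dots,P$, the denominators $\bar\sigma_q$ satisfy $(E_q)$, and the conclusions of (a) hold with $p=q$,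 for all $\gamma\in V$. If $(E_m)$ holds uniformly on a bounded set $W\subseteq V$, then all of this holds uniformly on $W$. If, moreover, $W$ is a neighbourhood of $1$ and $q\ge2$, then $u_q^{n+\gamma}=u(t_n+\gamma\Delta t)+O(\Delta t^{q+1})$ for every choice $\gamma=\gamma(\Delta t)=1+O(\Delta t^{q-1})$. -/

import Mathlib

open Filter Topology Asymptotics

/-- The open positive orthant of `ℝ^d`. -/
def posOrthant (d : ℕ) : Set (Fin d → ℝ) := {x | ∀ k, 0 < x k}

/-- An autonomous production-destruction-rest system
`u_k' = r^P_k(u) - r^D_k(u) + ∑_ν (p_{kν}(u) - d_{kν}(u))` with `p_{kν} = d_{νk}`, `p_{kk} = 0`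
and all rates nonnegative and continuously differentiable on the positive orthant. -/
structure PDRS (d : ℕ) where
  /-- rest production `r^P` -/
  rP : (Fin d → ℝ) → Fin d → ℝ
  /-- rest destruction `r^D` -/
  rD : (Fin d → ℝ) → Fin d → ℝ
  /-- production `p_{kν}(u)` is `prod u k ν` -/
  prod : (Fin d → ℝ) → Fin d → Fin d → ℝ
  rP_nonneg : ∀ x ∈ posOrthant d, ∀ k, 0 ≤ rP x k
  rD_nonneg : ∀ x ∈ posOrthant d, ∀ k, 0 ≤ rD x k
  prod_nonneg : ∀ x ∈ posOrthant d, ∀ k ν, 0 ≤ prod x k ν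
  prod_self : ∀ x ∈ posOrthant d, ∀ k, prod x k k = 0
  rP_smooth : ContDiffOn ℝ 1 rP (posOrthant d)
  rD_smooth : ContDiffOn ℝ 1 rD (posOrthant d)
  prod_smooth : ContDiffOn ℝ 1 prod (posOrthant d)

namespace PDRS

variable {d : ℕ}

/-- The destruction rates `d_{kν} = p_{νk}`. -/
def dest (S : PDRS d) (x : Fin d → ℝ) (k ν : Fin d) : ℝ := S.prod x ν k

/-- The right-hand side of the system. -/
def rhs (S : PDRS d) (x : Fin d → ℝ) (k : Fin d) : ℝ :=
  S.rP x k - S.rD x k + ∑ ν, (S.prod x k ν - S.dest x k ν)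

/-- `u` is a positive solution of the system on `[t₀, t₀ + T]` with `u(t₀) = u₀`. -/
def IsPosSolution (S : PDRS d) (t₀ T : ℝ) (u₀ : Fin d → ℝ) (u : ℝ → Fin d → ℝ) : Prop :=
  u t₀ = u₀ ∧ ∀ t ∈ Set.Icc t₀ (t₀ + T),
    u t ∈ posOrthant d ∧ HasDerivWithinAt u (S.rhs (u t)) (Set.Icc t₀ (t₀ + T)) t

/-- The modified Patankar equation: `v` is computed from `u₀` with step size `h`, weights `w_j`,
stage values `U_j` and Patankar-weight denominators `den`,
`v_k = u₀_k + h ∑_j w_j (r^P_k(U_j) + ∑_ν p_{kν}(U_j) v_ν / den_ν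
  - (r^D_k(U_j) + ∑_ν d_{kν}(U_j)) v_k / den_k)`. -/
def PatankarEq (S : PDRS d) {s : ℕ} (h : ℝ) (w : Fin s → ℝ) (U : Fin s → Fin d → ℝ)
    (u₀ den v : Fin d → ℝ) : Prop :=
  ∀ k, v k = u₀ k + h * ∑ j, w j *
    (S.rP (U j) k + ∑ ν, S.prod (U j) k ν * (v ν / den ν)
      - (S.rD (U j) k + ∑ ν, S.dest (U j) k ν) * (v k / den k))

end PDRS

/-- One step of a modified Patankar-Runge-Kutta scheme for the system `S`, started at `u₀`, as a
function of the (sufficiently small) step size `h > 0`. It is based on an explicit Runge-Kutta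
method with nonnegative Butcher array. The Patankar-weight denominators are positive, and those of
the stages do not degenerate as `h → 0`; this holds in particular whenever they are positive
continuous functions of `u₀` and of the previously computed stages. -/
structure MPRK {d : ℕ} (S : PDRS d) (u₀ : Fin d → ℝ) where
  /-- number of stages -/
  s : ℕ
  /-- Runge-Kutta matrix -/
  A : Fin s → Fin s → ℝ
  /-- Runge-Kutta weights -/
  b : Fin s → ℝ
  A_explicit : ∀ i j, i ≤ j → A i j = 0
  A_nonneg : ∀ i j, 0 ≤ A i j
  b_nonneg : ∀ j, 0 ≤ b j
  /-- denominators of the stages, `π^{(i)}` for step size `h` is `piDen h i` -/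
  piDen : ℝ → Fin s → Fin d → ℝ
  /-- denominators `σ` of the update -/
  sigma : ℝ → Fin d → ℝ
  /-- stage values, `u^{(i)}` for step size `h` is `stage h i` -/
  stage : ℝ → Fin s → Fin d → ℝ
  /-- the update `u^{n+1}` -/
  next : ℝ → Fin d → ℝ
  piDen_pos : ∃ c > 0, ∀ᶠ h in 𝓝[>] (0 : ℝ), ∀ i k, c ≤ piDen h i k
  sigma_pos : ∀ᶠ h in 𝓝[>] (0 : ℝ), sigma h ∈ posOrthant d
  stage_eq : ∀ᶠ h in 𝓝[>] (0 : ℝ), ∀ i,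
    S.PatankarEq h (A i) (stage h) u₀ (piDen h i) (stage h i)
  next_eq : ∀ᶠ h in 𝓝[>] (0 : ℝ), S.PatankarEq h b (stage h) u₀ (sigma h) (next h)

/-- The step is of order `p` along `u`: `u^{n+1} = u(t_n + h) + O(h^{p+1})` as `h → 0+`. -/
def MPRK.HasOrder {d : ℕ} {S : PDRS d} {u₀ : Fin d → ℝ} (B : MPRK S u₀)
    (u : ℝ → Fin d → ℝ) (tn : ℝ) (p : ℕ) : Prop :=
  (fun h => B.next h - u (tn + h)) =O[𝓝[>] (0 : ℝ)] fun h => h ^ (p + 1)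

/-- The relaxed dense output `u^{n+γ}`, `γ ∈ V`, attached to an MPRK step: the update equation with
`b_j` replaced by `γ b_j` and `σ` replaced by positive denominators `σ̄(γ)`; for `γ = 1` the
denominators, and hence the update, are those of the MPRK step. -/
structure RelaxedDenseOutput {d : ℕ} {S : PDRS d} {u₀ : Fin d → ℝ} (B : MPRK S u₀)
    (V : Set ℝ) where
  /-- `σ̄(γ)` for step size `h` is `sigmaBar h γ` -/
  sigmaBar : ℝ → ℝ → Fin d → ℝ
  /-- `u^{n+γ}` for step size `h` is `val h γ` -/
  val : ℝ → ℝ → Fin d → ℝ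
  sigmaBar_pos : ∀ᶠ h in 𝓝[>] (0 : ℝ), ∀ γ ∈ V, sigmaBar h γ ∈ posOrthant d
  sigmaBar_one : ∀ᶠ h in 𝓝[>] (0 : ℝ), sigmaBar h 1 = B.sigma h
  val_eq : ∀ᶠ h in 𝓝[>] (0 : ℝ), ∀ γ ∈ V,
    S.PatankarEq h (fun j => γ * B.b j) (B.stage h) u₀ (sigmaBar h γ) (val h γ)

/-- `r(h, γ) = O(h^q)` as `h → 0+`, uniformly for `γ ∈ W`. For `W = {γ}` this is the statement
for the single value `γ`. -/
def BigOPow {E : Type*} [Norm E] (W : Set ℝ) (q : ℕ) (r : ℝ → ℝ → E) : Prop :=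
  (fun x : ℝ × ℝ => r x.1 x.2) =O[𝓝[>] (0 : ℝ) ×ˢ 𝓟 W] fun x : ℝ × ℝ => x.1 ^ q

namespace RelaxedDenseOutput

variable {d : ℕ} {S : PDRS d} {u₀ : Fin d → ℝ} {B : MPRK S u₀} {V : Set ℝ}

/-- `σ̄(γ) = u(t_n + h) + (γ - 1)(u(t_n + h) - u(t_n)) + O(h^p)`, uniformly for `γ ∈ W`. -/
def DenominatorExpansion (D : RelaxedDenseOutput B V) (u : ℝ → Fin d → ℝ) (tn : ℝ)
    (p : ℕ) (W : Set ℝ) : Prop :=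
  BigOPow W p fun h γ =>
    D.sigmaBar h γ - (u (tn + h) + (γ - 1) • (u (tn + h) - u tn))

/-- `u^{n+γ}_ν / σ̄_ν(γ) = 1 + O(h^p) = u^{n+1}_ν / σ_ν + O(h^p)` for all `ν`, uniformly for
`γ ∈ W`. -/
def WeightExpansion (D : RelaxedDenseOutput B V) (p : ℕ) (W : Set ℝ) : Prop :=
  ∀ ν, (BigOPow W p fun h γ => D.val h γ ν / D.sigmaBar h γ ν - 1) ∧
    (BigOPow W p fun h γ => D.val h γ ν / D.sigmaBar h γ ν - B.next h ν / B.sigma h ν)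

/-- `u^{n+γ} = u^{n+1} + (γ - 1)(u^{n+1} - u^n) + O(h^{p+1})`, uniformly for `γ ∈ W`. -/
def UpdateExpansion (D : RelaxedDenseOutput B V) (p : ℕ) (W : Set ℝ) : Prop :=
  BigOPow W (p + 1) fun h γ =>
    D.val h γ - (B.next h + (γ - 1) • (B.next h - u₀))

/-- For every choice of relaxation parameters `γ(h) = 1 + O(h^{p-1})`, the relaxed update is of
order `p`: `u^{n+γ} = u(t_n + γ h) + O(h^{p+1})`. Used for `p ≥ 2` only. -/
def RelaxedOrder (D : RelaxedDenseOutput B V) (u : ℝ → Fin d → ℝ) (tn : ℝ) (p : ℕ) : Prop :=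
  ∀ γ : ℝ → ℝ, ((fun h => γ h - 1) =O[𝓝[>] (0 : ℝ)] fun h => h ^ (p - 1)) →
    (fun h => D.val h (γ h) - u (tn + γ h * h)) =O[𝓝[>] (0 : ℝ)] fun h => h ^ (p + 1)

end RelaxedDenseOutput

/-!
Write the Patankar equation as `v = u₀ + h ∑_j w_j F(U_j, v / den)`, where `F` (`patankarField`) is
affine in the vector of Patankar weights `v / den`. Near `u₀` the coefficients of `F` are bounded,
so `F` is Lipschitz in the weights, uniformly along stages converging to `u₀`; and the stages do
converge to `u₀` (`MPRK.tendsto_stage`), because their equations give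
`u⁽ⁱ⁾ - u₀ = O(h (1 + ‖u⁽ⁱ⁾ - u₀‖))`.

Let `y = u^{n+1} + (γ - 1)(u^{n+1} - u^n) = u^n + γ (u^{n+1} - u^n)`. Subtracting `γ` times the
equation of the update from that of the relaxed output leaves
`u^{n+γ} - y = h γ ∑_j b_j (F(U_j, ω(γ)) - F(U_j, ω(1))) = O(h ‖ω(γ) - ω(1)‖)`, where
`ω(γ) = u^{n+γ} / σ̄(γ)` (`val_sub_extrapolation_isBigO`). The order of the step turns the expansion
of the denominators into `σ̄(γ) = y + O(h^p)`, so
`ω(γ) - 1 = (u^{n+γ} - σ̄(γ)) / σ̄(γ) = O(h ‖ω(γ) - ω(1)‖) + O(h^p)`. Since `ω(1) = 1 + O(h^p)`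
by the order of the step, the term `O(h ‖ω(γ) - 1‖)` can be absorbed on the left (`isBigO_of_absorb`),
which gives `ω(γ) = 1 + O(h^p)` and then `u^{n+γ} = y + O(h^{p+1})`. All estimates are made along the
filter `𝓝[>] 0 ×ˢ 𝓟 W`, which makes them uniform on `W`; a single `γ` is the case `W = {γ}`.

The last estimate, with `u^{n+1}` replaced by `u(t_n + h)`, is the expansion of the denominators of
one order higher, so the bootstrap is an induction on the order. Finally,
`u(t_n + γ h)` differs from the linear extrapolation of `u(t_n)` and `u(t_n + h)` by
`O(|γ - 1| h²)` (`PDRS.IsPosSolution.extrapolation_isBigO`), which is `O(h^{q+1})` if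
`γ = 1 + O(h^{q-1})`.
-/

/-! ### Asymptotic estimates -/

/-- Absorption: a term `ε ‖f‖` with `ε → 0` in a bound for `f` may be dropped. -/
theorem isBigO_of_absorb {α E : Type*} [NormedAddCommGroup E] {l : Filter α} {f : α → E}
    {ε g : α → ℝ} (hε : Tendsto ε l (𝓝 0)) (hf : f =O[l] fun x => ε x * ‖f x‖ + g x) :
    f =O[l] g := by
  obtain ⟨C, hC, hb⟩ := hf.exists_pos
  have hsmall : ∀ᶠ x in l, ‖ε x‖ < 1 / (2 * C) := by
    exact (tendsto_norm_zero.comp hε).eventually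
      (gt_mem_nhds (show 0 < 1 / (2 * C) by positivity))
  refine IsBigO.of_bound (2 * C) ?_
  filter_upwards [hb.bound, hsmall] with x hx hs
  have h1 : ‖ε x * ‖f x‖ + g x‖ ≤ ‖ε x‖ * ‖f x‖ + ‖g x‖ := by
    refine (norm_add_le _ _).trans ?_
    rw [norm_mul, norm_norm]
  have h2 : C * (‖ε x‖ * ‖f x‖) ≤ ‖f x‖ / 2 := by
    have h3 : C * ‖ε x‖ ≤ 1 / 2 := by
      rw [lt_div_iff₀ (by positivity)] at hs
      linarith
    nlinarith [norm_nonneg (f x)]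
  nlinarith [mul_le_mul_of_nonneg_left h1 hC.le]

/-- Dividing coordinatewise by denominators with bounded inverses does not change the order. -/
theorem isBigO_pi_div {α : Type*} {d : ℕ} {l : Filter α} {f den : α → Fin d → ℝ}
    (hden : ∀ k, (fun x => (den x k)⁻¹) =O[l] fun _ => (1 : ℝ)) :
    (fun x => f x / den x) =O[l] f := by
  refine isBigO_pi.2 fun k => ?_
  have h1 : (fun x => f x k) =O[l] f := isBigO_pi.1 (isBigO_refl f l) k
  simpa [div_eq_mul_inv] using h1.norm_right.mul (hden k)

theorem inv_isBigO_one_of_tendsto {α : Type*} {d : ℕ} {l : Filter α} {den : α → Fin d → ℝ}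
    {a : Fin d → ℝ} (ha : a ∈ posOrthant d) (h : Tendsto den l (𝓝 a)) (k : Fin d) :
    (fun x => (den x k)⁻¹) =O[l] fun _ => (1 : ℝ) :=
  ((tendsto_pi_nhds.1 h k).inv₀ (ha k).ne').isBigO_one ℝ

theorem isOpen_posOrthant (d : ℕ) : IsOpen (posOrthant d) := by
  have : posOrthant d = ⋂ k, {x : Fin d → ℝ | 0 < x k} := by
    ext x
    simp [posOrthant]
  rw [this]
  exact isOpen_iInter_of_finite fun k => isOpen_lt continuous_const (continuous_apply k)

theorem tendsto_step_zero : Tendsto (fun h : ℝ => h) (𝓝[>] 0) (𝓝 0) :=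
  tendsto_id.mono_left nhdsWithin_le_nhds

theorem step_pow_isBigO {m n : ℕ} (h : n ≤ m) :
    (fun x : ℝ => x ^ m) =O[𝓝[>] (0 : ℝ)] fun x => x ^ n :=
  IsBigO.of_norm_eventuallyLE <| by
    filter_upwards [Ioc_mem_nhdsGT one_pos] with x hx
    rw [Real.norm_of_nonneg (pow_nonneg hx.1.le _)]
    exact pow_le_pow_of_le_one hx.1.le hx.2 h

/-! ### The Patankar equation -/

namespace PDRS

variable {d : ℕ}

/-- The right-hand side of the Patankar equation, `ω` being the vector of the quotients
`v_ν / den_ν`; for `ω = 1` it is the right-hand side of the system. -/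
def patankarField (S : PDRS d) (x ω : Fin d → ℝ) (k : Fin d) : ℝ :=
  S.rP x k + ∑ ν, S.prod x k ν * ω ν - (S.rD x k + ∑ ν, S.dest x k ν) * ω k

theorem patankarEq_iff (S : PDRS d) {s : ℕ} (h : ℝ) (w : Fin s → ℝ) (U : Fin s → Fin d → ℝ)
    (u₀ den v : Fin d → ℝ) :
    S.PatankarEq h w U u₀ den v ↔
      v = u₀ + h • ∑ j, w j • S.patankarField (U j) (v / den) := by
  simp [PatankarEq, funext_iff, patankarField]

theorem rP_differentiableAt (S : PDRS d) {a : Fin d → ℝ} (ha : a ∈ posOrthant d) (k : Fin d) :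
    DifferentiableAt ℝ (fun x => S.rP x k) a :=
  differentiableAt_pi.1 ((S.rP_smooth.contDiffAt
    ((isOpen_posOrthant d).mem_nhds ha)).differentiableAt one_ne_zero) k

theorem rD_differentiableAt (S : PDRS d) {a : Fin d → ℝ} (ha : a ∈ posOrthant d) (k : Fin d) :
    DifferentiableAt ℝ (fun x => S.rD x k) a :=
  differentiableAt_pi.1 ((S.rD_smooth.contDiffAt
    ((isOpen_posOrthant d).mem_nhds ha)).differentiableAt one_ne_zero) k

theorem prod_differentiableAt (S : PDRS d) {a : Fin d → ℝ} (ha : a ∈ posOrthant d)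
    (k ν : Fin d) : DifferentiableAt ℝ (fun x => S.prod x k ν) a :=
  differentiableAt_pi.1 (differentiableAt_pi.1
    ((S.prod_smooth.contDiffAt ((isOpen_posOrthant d).mem_nhds ha)).differentiableAt
      one_ne_zero) k) ν

theorem rhs_differentiableAt (S : PDRS d) {a : Fin d → ℝ} (ha : a ∈ posOrthant d) :
    DifferentiableAt ℝ S.rhs a := by
  refine differentiableAt_pi.2 fun k => ?_
  unfold rhs dest
  exact ((S.rP_differentiableAt ha k).sub (S.rD_differentiableAt ha k)).add
    (DifferentiableAt.fun_sum fun ν _ =>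
      (S.prod_differentiableAt ha k ν).sub (S.prod_differentiableAt ha ν k))

section Field

variable {α : Type*} {l : Filter α} {S : PDRS d} {a : Fin d → ℝ} {U ω ω' : α → Fin d → ℝ}

theorem patankarField_sub_isBigO (ha : a ∈ posOrthant d) (hU : Tendsto U l (𝓝 a)) :
    (fun x => S.patankarField (U x) (ω x) - S.patankarField (U x) (ω' x))
      =O[l] fun x => ω x - ω' x := by
  refine isBigO_pi.2 fun k => ?_
  have hprod : ∀ i j, (fun x => S.prod (U x) i j) =O[l] fun _ => (1 : ℝ) := fun i j =>
    ((S.prod_differentiableAt ha i j).continuousAt.tendsto.comp hU).isBigO_one ℝ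
  have hrD : (fun x => S.rD (U x) k) =O[l] fun _ => (1 : ℝ) :=
    ((S.rD_differentiableAt ha k).continuousAt.tendsto.comp hU).isBigO_one ℝ
  have hω : ∀ ν, (fun x => ω x ν - ω' x ν) =O[l] fun x => ‖ω x - ω' x‖ := fun ν =>
    (isBigO_pi.1 (isBigO_refl (fun x => ω x - ω' x) l) ν).norm_right
  have h1 : (fun x => ∑ ν, S.prod (U x) k ν * (ω x ν - ω' x ν)) =O[l]
      fun x => ‖ω x - ω' x‖ :=
    IsBigO.fun_sum fun ν _ => by simpa using (hprod k ν).mul (hω ν)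
  have h2 : (fun x => (S.rD (U x) k + ∑ ν, S.dest (U x) k ν) * (ω x k - ω' x k)) =O[l]
      fun x => ‖ω x - ω' x‖ :=
    ((hrD.add (IsBigO.fun_sum fun ν _ => hprod ν k)).mul (hω k)).congr_right fun x => one_mul _
  refine ((h1.sub h2).congr_left fun x => ?_).of_norm_right
  simp only [patankarField, Pi.sub_apply, mul_sub, Finset.sum_sub_distrib]
  ring

theorem patankarField_isBigO (ha : a ∈ posOrthant d) (hU : Tendsto U l (𝓝 a)) :
    (fun x => S.patankarField (U x) (ω x)) =O[l] fun x => ‖ω x‖ + 1 := by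
  have h0 : (fun x => S.patankarField (U x) 0) =O[l] fun _ => (1 : ℝ) := by
    refine isBigO_pi.2 fun k => ?_
    simpa [patankarField] using
      ((S.rP_differentiableAt ha k).continuousAt.tendsto.comp hU).isBigO_one ℝ
  have h1 := (patankarField_sub_isBigO (S := S) (ω := ω) (ω' := fun _ => 0) ha hU)
  have hle : (fun x => ω x - 0) =O[l] fun x => ‖ω x‖ + 1 :=
    IsBigO.of_norm_le fun x => by simp
  have hle' : (fun _ => (1 : ℝ)) =O[l] fun x => ‖ω x‖ + 1 :=
    IsBigO.of_norm_le fun x => by simp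
  simpa using (h1.trans hle).add (h0.trans hle')

end Field

/-! ### Expansion of the solution -/

namespace IsPosSolution

variable {S : PDRS d} {u₀ : Fin d → ℝ} {tn T : ℝ} {u : ℝ → Fin d → ℝ}

theorem initial_mem (hu : S.IsPosSolution tn T u₀ u) (hT : 0 < T) : u₀ ∈ posOrthant d :=
  hu.1 ▸ (hu.2 tn ⟨le_rfl, by linarith⟩).1

theorem sub_initial_isBigO (hu : S.IsPosSolution tn T u₀ u) (hT : 0 < T) :
    (fun h => u (tn + h) - u₀) =O[𝓝[≥] (0 : ℝ)] fun h => h := by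
  have hd := (hu.2 tn ⟨le_rfl, by linarith⟩).2.differentiableWithinAt.isBigO_sub
  have hmap : Tendsto (fun h : ℝ => tn + h) (𝓝[≥] 0) (𝓝[Set.Icc tn (tn + T)] tn) := by
    refine tendsto_nhdsWithin_iff.2 ⟨?_, ?_⟩
    · exact ((continuous_const.add continuous_id).tendsto' 0 tn (by simp)).mono_left
        nhdsWithin_le_nhds
    · filter_upwards [Icc_mem_nhdsGE hT] with h hh
      exact ⟨by linarith [hh.1], by linarith [hh.2]⟩
  simpa [Function.comp_def, hu.1] using hd.comp_tendsto hmap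

/-- Since `u'` is Lipschitz at `tn`, increments of `u` near `tn` are given by the initial slope up
to an error `O(|x - y| h)`, uniformly for `x`, `y` in `[0, h]`. -/
theorem exists_increment_bound (hu : S.IsPosSolution tn T u₀ u) (hT : 0 < T) :
    ∃ C > 0, ∃ δ > 0, ∀ h ≤ δ, ∀ x ∈ Set.Icc 0 h, ∀ y ∈ Set.Icc 0 h,
      ‖u (tn + y) - u (tn + x) - (y - x) • S.rhs u₀‖ ≤ C * h * |y - x| := by
  have ha := hu.initial_mem hT
  have hsub := hu.sub_initial_isBigO hT
  have htend : Tendsto (fun h => u (tn + h)) (𝓝[≥] (0 : ℝ)) (𝓝 u₀) := by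
    have h0 : Tendsto (fun h : ℝ => h) (𝓝[≥] 0) (𝓝 0) := tendsto_id.mono_left nhdsWithin_le_nhds
    simpa using (hsub.trans_tendsto h0).add_const u₀
  have hder : (fun h => S.rhs (u (tn + h)) - S.rhs u₀) =O[𝓝[≥] (0 : ℝ)] fun h => h :=
    ((S.rhs_differentiableAt ha).isBigO_sub.comp_tendsto htend).trans hsub
  obtain ⟨C, hC, hb⟩ := hder.exists_pos
  obtain ⟨δ, hδ, hsubset⟩ := (mem_nhdsGE_iff_exists_Icc_subset).1 hb.bound
  refine ⟨C, hC, min δ T, lt_min hδ hT, fun h hh x hx y hy => ?_⟩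
  have hd : ∀ t ∈ Set.Icc 0 h, HasDerivWithinAt (fun t => u (tn + t) - t • S.rhs u₀)
      (S.rhs (u (tn + t)) - S.rhs u₀) (Set.Icc 0 h) t := by
    intro t ht
    have hT' : h ≤ T := hh.trans (min_le_right _ _)
    have h1 := (hu.2 (tn + t) ⟨by linarith [ht.1], by linarith [ht.2]⟩).2
    have h2 : HasDerivWithinAt (fun t => tn + t) 1 (Set.Icc 0 h) t :=
      ((hasDerivAt_id t).const_add tn).hasDerivWithinAt
    have h3 := h1.scomp t h2 fun z hz => ⟨by linarith [hz.1], by linarith [hz.2]⟩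
    have h4 := ((hasDerivAt_id t).smul_const (S.rhs u₀)).hasDerivWithinAt (s := Set.Icc 0 h)
    exact (h3.sub h4).congr_deriv (by simp)
  have := Convex.norm_image_sub_le_of_norm_hasDerivWithin_le (C := C * h) hd
    (fun t ht => ?_) (convex_Icc 0 h) hx hy
  · refine le_of_eq_of_le (congrArg _ ?_) this
    rw [sub_smul]
    abel
  · have h1 := hsubset ⟨ht.1, ht.2.trans (hh.trans (min_le_left _ _))⟩
    refine (show _ ≤ _ from h1).trans ?_
    rw [Real.norm_of_nonneg ht.1]
    exact mul_le_mul_of_nonneg_left ht.2 hC.le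

/-- The linear extrapolation of `u` through `tn` and `tn + h`, evaluated at `tn + γ h` with
`γ → 1`, has an error `O(|γ - 1| h²)`. -/
theorem extrapolation_isBigO (hu : S.IsPosSolution tn T u₀ u) (hT : 0 < T) {γ : ℝ → ℝ}
    (hγ : Tendsto γ (𝓝[>] 0) (𝓝 1)) :
    (fun h => u (tn + h) + (γ h - 1) • (u (tn + h) - u₀) - u (tn + γ h * h))
      =O[𝓝[>] (0 : ℝ)] fun h => (γ h - 1) * h ^ 2 := by
  obtain ⟨C, hC, δ, hδ, hb⟩ := hu.exists_increment_bound hT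
  refine IsBigO.of_bound (4 * C) ?_
  filter_upwards [hγ.eventually (Icc_mem_nhds (show (0 : ℝ) < 1 by norm_num) one_lt_two),
    Ioc_mem_nhdsGT (show 0 < δ / 2 by positivity)] with h hg hh
  have hpos : 0 < h := hh.1
  -- Both `h` and `γ h` lie in `[0, 2 h]`.
  have h1 := hb (2 * h) (by linarith [hh.2]) h ⟨hpos.le, by linarith⟩ (γ h * h)
    ⟨mul_nonneg hg.1 hpos.le, by nlinarith [hg.2]⟩
  have h2 := hb (2 * h) (by linarith [hh.2]) 0 ⟨le_rfl, by linarith⟩ h ⟨hpos.le, by linarith⟩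
  rw [add_zero, hu.1, sub_zero, abs_of_pos hpos] at h2
  have e : u (tn + h) + (γ h - 1) • (u (tn + h) - u₀) - u (tn + γ h * h)
      = (γ h - 1) • (u (tn + h) - u₀ - h • S.rhs u₀)
        - (u (tn + γ h * h) - u (tn + h) - (γ h * h - h) • S.rhs u₀) := by
    module
  have e2 : |γ h * h - h| = |γ h - 1| * h := by
    rw [← abs_of_pos hpos, ← abs_mul, abs_of_pos hpos]
    ring_nf
  rw [e]
  refine (norm_sub_le _ _).trans ?_
  rw [norm_smul, norm_mul, Real.norm_eq_abs, norm_pow, Real.norm_of_nonneg hpos.le]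
  rw [e2] at h1
  have h3 := mul_le_mul_of_nonneg_left h2 (abs_nonneg (γ h - 1))
  linarith

end IsPosSolution

end PDRS

/-! ### Stages and relaxed outputs -/

theorem MPRK.tendsto_stage {d : ℕ} {S : PDRS d} {u₀ : Fin d → ℝ} (B : MPRK S u₀)
    (ha : u₀ ∈ posOrthant d) (i : Fin B.s) :
    Tendsto (fun h => B.stage h i) (𝓝[>] 0) (𝓝 u₀) := by
  induction i using WellFoundedLT.induction with
  | ind i ih =>
    obtain ⟨c, hc, hden⟩ := B.piDen_pos
    have hinv : ∀ k, (fun h => (B.piDen h i k)⁻¹) =O[𝓝[>] (0 : ℝ)] fun _ => (1 : ℝ) := by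
      refine fun k => IsBigO.of_bound c⁻¹ ?_
      filter_upwards [hden] with h hh
      have := hh i k
      rw [norm_inv, Real.norm_of_nonneg (hc.le.trans this), norm_one, mul_one]
      exact inv_anti₀ hc this
    have hω : (fun h => ‖B.stage h i / B.piDen h i‖ + 1) =O[𝓝[>] (0 : ℝ)]
        fun h => ‖B.stage h i - u₀‖ + 1 := by
      have hone : (fun _ => (1 : ℝ)) =O[𝓝[>] (0 : ℝ)] fun h => ‖B.stage h i - u₀‖ + 1 :=
        IsBigO.of_norm_le fun h => by simp
      have hdiff : (fun h => B.stage h i - u₀) =O[𝓝[>] (0 : ℝ)]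
          fun h => ‖B.stage h i - u₀‖ + 1 := IsBigO.of_norm_le fun h => by simp
      have hst : (fun h => B.stage h i) =O[𝓝[>] (0 : ℝ)] fun h => ‖B.stage h i - u₀‖ + 1 := by
        simpa using hdiff.add ((isBigO_const_const u₀ one_ne_zero _).trans hone)
      exact ((isBigO_pi_div hinv).trans hst).norm_left.add hone
    have hsum : (fun h => ∑ j, B.A i j •
        S.patankarField (B.stage h j) (B.stage h i / B.piDen h i)) =O[𝓝[>] (0 : ℝ)]
        fun h => ‖B.stage h i - u₀‖ + 1 := by
      refine IsBigO.fun_sum fun j _ => ?_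
      rcases lt_or_ge j i with hj | hj
      · exact ((PDRS.patankarField_isBigO (S := S) ha (ih j hj)).trans hω).const_smul_left (B.A i j)
      · simp only [B.A_explicit i j hj, zero_smul]
        exact isBigO_zero _ _
    have hmain : (fun h => B.stage h i - u₀) =O[𝓝[>] (0 : ℝ)]
        fun h => h * ‖B.stage h i - u₀‖ + h := by
      refine ((isBigO_refl (fun h : ℝ => h) _).smul hsum).congr' ?_ ?_
      · filter_upwards [B.stage_eq] with h hh
        rw [eq_sub_iff_add_eq']
        exact ((S.patankarEq_iff ..).1 (hh i)).symm
      · exact Eventually.of_forall fun h => by simp only [smul_eq_mul]; ring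
    simpa using ((isBigO_of_absorb tendsto_step_zero hmain).trans_tendsto
      tendsto_step_zero).add_const u₀

theorem bigOPow_of_isBigO {E : Type*} [Norm E] {q : ℕ} {r : ℝ → E}
    (h : r =O[𝓝[>] (0 : ℝ)] fun x => x ^ q) (W : Set ℝ) : BigOPow W q fun x _ => r x :=
  h.comp_tendsto tendsto_fst

theorem BigOPow.of_le {E : Type*} [Norm E] {W : Set ℝ} {q q' : ℕ} {r : ℝ → ℝ → E}
    (h : BigOPow W q r) (hq : q' ≤ q) : BigOPow W q' r :=
  IsBigO.trans h ((step_pow_isBigO hq).comp_tendsto tendsto_fst)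

/-- Evaluation along a choice `γ(h)` that eventually stays in the set of uniformity. -/
theorem BigOPow.comp {E : Type*} [Norm E] {W : Set ℝ} {q : ℕ} {r : ℝ → ℝ → E}
    (h : BigOPow W q r) {γ : ℝ → ℝ} (hγ : ∀ᶠ x in 𝓝[>] (0 : ℝ), γ x ∈ W) :
    (fun x => r x (γ x)) =O[𝓝[>] (0 : ℝ)] fun x => x ^ q :=
  h.comp_tendsto (k := fun x => (x, γ x)) (tendsto_id.prodMk (tendsto_principal.2 hγ))

theorem isBigO_snd_of_isBounded {W : Set ℝ} (hW : Bornology.IsBounded W) :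
    (fun x : ℝ × ℝ => x.2) =O[𝓝[>] (0 : ℝ) ×ˢ 𝓟 W] fun _ => (1 : ℝ) := by
  obtain ⟨R, hR⟩ := hW.exists_norm_le
  refine IsBigO.of_bound R (eventually_prod_principal_iff.2 (Eventually.of_forall fun h γ hγ => ?_))
  simpa using hR γ hγ

/-- Replacing the update by the solution in the extrapolated update costs `O(h^{p+1})`. -/
theorem MPRK.HasOrder.extrapolation_bigOPow {d : ℕ} {S : PDRS d} {u₀ : Fin d → ℝ}
    {B : MPRK S u₀} {u : ℝ → Fin d → ℝ} {tn : ℝ} {p : ℕ} (hB : B.HasOrder u tn p)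
    (h0 : u tn = u₀) {W : Set ℝ} (hW : Bornology.IsBounded W) :
    BigOPow W (p + 1) fun h γ => (B.next h + (γ - 1) • (B.next h - u₀))
      - (u (tn + h) + (γ - 1) • (u (tn + h) - u tn)) := by
  refine ((isBigO_snd_of_isBounded hW).smul (bigOPow_of_isBigO hB W)).congr (fun x => ?_)
    fun x => by simp
  rw [h0]
  module

namespace RelaxedDenseOutput

variable {d : ℕ} {S : PDRS d} {u₀ : Fin d → ℝ} {B : MPRK S u₀} {V : Set ℝ}
  {u : ℝ → Fin d → ℝ} {tn T : ℝ} {p : ℕ} {W : Set ℝ}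

theorem DenominatorExpansion.tendsto_sigmaBar {D : RelaxedDenseOutput B V}
    (hD : D.DenominatorExpansion u tn p W) (hp : 1 ≤ p) (hu : S.IsPosSolution tn T u₀ u)
    (hT : 0 < T) (hW : Bornology.IsBounded W) :
    Tendsto (fun x : ℝ × ℝ => D.sigmaBar x.1 x.2) (𝓝[>] (0 : ℝ) ×ˢ 𝓟 W) (𝓝 u₀) := by
  have h0 : Tendsto (fun x : ℝ × ℝ => x.1) (𝓝[>] (0 : ℝ) ×ˢ 𝓟 W) (𝓝 0) :=
    tendsto_step_zero.comp tendsto_fst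
  have h1 := BigOPow.of_le hD hp
  have h2 := ((hu.sub_initial_isBigO hT).mono
    (nhdsWithin_mono (0 : ℝ) Set.Ioi_subset_Ici_self)).comp_tendsto
      (tendsto_fst (f := 𝓝[>] (0 : ℝ)) (g := 𝓟 W))
  have h3 := (isBigO_snd_of_isBounded hW).smul h2
  have h4 : (fun x : ℝ × ℝ => D.sigmaBar x.1 x.2 - u₀) =O[𝓝[>] (0 : ℝ) ×ˢ 𝓟 W]
      fun x => x.1 := by
    refine (IsBigO.add (IsBigO.congr_right h1 fun x => pow_one _)
      (h3.congr_right fun x => by simp)).congr_left fun x => ?_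
    simp only [Function.comp_apply, hu.1]
    module
  simpa using (h4.trans_tendsto h0).add_const u₀

/-- At `γ = 1` the denominators are those of the step, and both they and the update approximate
`u (tn + h)` up to `O(h^p)`; hence their quotients are `1 + O(h^p)`. -/
theorem DenominatorExpansion.next_div_sigma_isBigO {D : RelaxedDenseOutput B V}
    (hD : D.DenominatorExpansion u tn p {1}) (hp : 1 ≤ p) (hu : S.IsPosSolution tn T u₀ u)
    (hT : 0 < T) (hB : B.HasOrder u tn p) :
    (fun h => B.next h / B.sigma h - 1) =O[𝓝[>] (0 : ℝ)] fun h => h ^ p := by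
  have hmem : ∀ᶠ _ in 𝓝[>] (0 : ℝ), (1 : ℝ) ∈ ({1} : Set ℝ) := Eventually.of_forall fun _ => rfl
  have hσ : Tendsto B.sigma (𝓝[>] 0) (𝓝 u₀) := by
    refine ((hD.tendsto_sigmaBar hp hu hT Bornology.isBounded_singleton).comp
      (tendsto_id.prodMk (tendsto_principal.2 hmem))).congr' ?_
    filter_upwards [D.sigmaBar_one] with h hh using hh
  have h1 : (fun h => B.next h - B.sigma h) =O[𝓝[>] (0 : ℝ)] fun h => h ^ p := by
    refine (IsBigO.sub (IsBigO.trans hB (step_pow_isBigO p.le_succ)) (BigOPow.comp hD hmem)).congr'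
      ?_ EventuallyEq.rfl
    filter_upwards [D.sigmaBar_one] with h hh
    rw [hh, sub_self, zero_smul]
    abel
  refine IsBigO.congr' ((isBigO_pi_div
    (inv_isBigO_one_of_tendsto (hu.initial_mem hT) hσ)).trans h1) ?_ EventuallyEq.rfl
  filter_upwards [B.sigma_pos] with h hh
  ext k
  simp [sub_div, div_self (hh k).ne']

/-- The relaxed output is compared with the extrapolated update by subtracting `γ` times the
equation of the update from the equation of the relaxed output. -/
theorem val_sub_extrapolation_isBigO (D : RelaxedDenseOutput B V) (ha : u₀ ∈ posOrthant d)
    (hWV : W ⊆ V) (hW : Bornology.IsBounded W) :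
    (fun x : ℝ × ℝ => D.val x.1 x.2 - (B.next x.1 + (x.2 - 1) • (B.next x.1 - u₀)))
      =O[𝓝[>] (0 : ℝ) ×ˢ 𝓟 W] fun x => x.1 *
        ‖D.val x.1 x.2 / D.sigmaBar x.1 x.2 - B.next x.1 / B.sigma x.1‖ := by
  have hsum : (fun x : ℝ × ℝ => ∑ j, B.b j •
      (S.patankarField (B.stage x.1 j) (D.val x.1 x.2 / D.sigmaBar x.1 x.2)
        - S.patankarField (B.stage x.1 j) (B.next x.1 / B.sigma x.1)))
      =O[𝓝[>] (0 : ℝ) ×ˢ 𝓟 W]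
        fun x => ‖D.val x.1 x.2 / D.sigmaBar x.1 x.2 - B.next x.1 / B.sigma x.1‖ :=
    IsBigO.fun_sum fun j _ => ((PDRS.patankarField_sub_isBigO ha
      ((B.tendsto_stage ha j).comp tendsto_fst)).norm_right).const_smul_left (B.b j)
  refine ((isBigO_refl (fun x : ℝ × ℝ => x.1) _).smul
    ((isBigO_snd_of_isBounded hW).smul hsum)).congr' ?_ ?_
  · refine eventually_prod_principal_iff.2 ?_
    filter_upwards [D.val_eq, B.next_eq] with h hv hn γ hγ
    have e1 := (S.patankarEq_iff ..).1 (hv γ (hWV hγ))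
    have e2 := (S.patankarEq_iff ..).1 hn
    simp only [mul_smul, ← Finset.smul_sum] at e1
    simp only [smul_sub (B.b _), Finset.sum_sub_distrib]
    generalize ∑ j, B.b j • S.patankarField (B.stage h j) (D.val h γ / D.sigmaBar h γ) = X at e1 ⊢
    generalize ∑ j, B.b j • S.patankarField (B.stage h j) (B.next h / B.sigma h) = Y at e2 ⊢
    rw [e1, e2]
    module
  · exact Eventually.of_forall fun x => by simp

/-- Uniform version on a bounded set `W`, which need not contain `1`; the expansion at `γ = 1` is
assumed separately because it controls the weights of the step itself. -/
theorem DenominatorExpansion.weightExpansion_and_updateExpansion {D : RelaxedDenseOutput B V}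
    (hD : D.DenominatorExpansion u tn p W) (hD1 : D.DenominatorExpansion u tn p {1})
    (hp : 1 ≤ p) (hu : S.IsPosSolution tn T u₀ u) (hT : 0 < T) (hB : B.HasOrder u tn p)
    (hWV : W ⊆ V) (hW : Bornology.IsBounded W) :
    D.WeightExpansion p W ∧ D.UpdateExpansion p W := by
  have ha := hu.initial_mem hT
  have hval := D.val_sub_extrapolation_isBigO ha hWV hW
  have hω1 := bigOPow_of_isBigO (hD1.next_div_sigma_isBigO hp hu hT hB) W
  have hstep : Tendsto (fun x : ℝ × ℝ => x.1) (𝓝[>] (0 : ℝ) ×ˢ 𝓟 W) (𝓝 0) :=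
    tendsto_step_zero.comp tendsto_fst
  have hsmall : ∀ᶠ x : ℝ × ℝ in 𝓝[>] (0 : ℝ) ×ˢ 𝓟 W, x.1 ∈ Set.Ioc 0 1 :=
    tendsto_fst.eventually (Ioc_mem_nhdsGT one_pos)
  have hσ : BigOPow W p fun h γ =>
      D.sigmaBar h γ - (B.next h + (γ - 1) • (B.next h - u₀)) :=
    (IsBigO.sub hD ((hB.extrapolation_bigOPow hu.1 hW).of_le p.le_succ)).congr_left
      fun x => by module
  have hω : BigOPow W p fun h γ => D.val h γ / D.sigmaBar h γ - 1 := by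
    -- The weights enter their own bound only with a factor `h`.
    refine isBigO_of_absorb hstep ?_
    have h1 : (fun x : ℝ × ℝ => D.val x.1 x.2 / D.sigmaBar x.1 x.2 - 1)
        =O[𝓝[>] (0 : ℝ) ×ˢ 𝓟 W] fun x => D.val x.1 x.2 - D.sigmaBar x.1 x.2 := by
      refine IsBigO.congr' (isBigO_pi_div
        (inv_isBigO_one_of_tendsto ha (hD.tendsto_sigmaBar hp hu hT hW))) ?_ EventuallyEq.rfl
      refine eventually_prod_principal_iff.2 ?_
      filter_upwards [D.sigmaBar_pos] with h hh γ hγ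
      ext k
      simp [sub_div, div_self (hh γ (hWV hγ) k).ne']
    refine h1.trans ((IsBigO.sub (hval.trans ?_) (IsBigO.trans hσ ?_)).congr_left fun x => ?_)
    · have h2 : (fun x : ℝ × ℝ => D.val x.1 x.2 / D.sigmaBar x.1 x.2 - B.next x.1 / B.sigma x.1)
          =O[𝓝[>] (0 : ℝ) ×ˢ 𝓟 W]
            fun x => ‖D.val x.1 x.2 / D.sigmaBar x.1 x.2 - 1‖ + x.1 ^ p := by
        refine (IsBigO.sub (f₁ := fun x : ℝ × ℝ => D.val x.1 x.2 / D.sigmaBar x.1 x.2 - 1)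
          (IsBigO.of_norm_eventuallyLE ?_)
          (IsBigO.trans hω1 (IsBigO.of_norm_eventuallyLE ?_))).congr_left
            fun x => sub_sub_sub_cancel_right _ _ _
        all_goals
          filter_upwards [hsmall] with x hx
          have := pow_pos hx.1 p
          have := norm_nonneg (D.val x.1 x.2 / D.sigmaBar x.1 x.2 - 1)
          try rw [Real.norm_of_nonneg (pow_pos hx.1 p).le]
          linarith
      refine ((isBigO_refl (fun x : ℝ × ℝ => x.1) _).mul h2.norm_left).trans
        (IsBigO.of_norm_eventuallyLE ?_)
      filter_upwards [hsmall] with x hx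
      have h3 := hx.1
      rw [Real.norm_of_nonneg (by positivity), mul_add]
      have := mul_le_of_le_one_left (pow_pos h3 p).le hx.2
      linarith
    · refine IsBigO.of_norm_eventuallyLE ?_
      filter_upwards [hsmall] with x hx
      have h3 := hx.1
      rw [Real.norm_of_nonneg (by positivity)]
      have : 0 ≤ x.1 * ‖D.val x.1 x.2 / D.sigmaBar x.1 x.2 - 1‖ := by positivity
      linarith
    · module
  have hdiff : BigOPow W p fun h γ =>
      D.val h γ / D.sigmaBar h γ - B.next h / B.sigma h :=
    (IsBigO.sub hω hω1).congr_left fun x => sub_sub_sub_cancel_right _ _ _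
  refine ⟨fun ν => ⟨isBigO_pi.1 hω ν, isBigO_pi.1 hdiff ν⟩, hval.trans ?_⟩
  refine ((isBigO_refl (fun x : ℝ × ℝ => x.1) _).mul (IsBigO.norm_left hdiff)).congr_right
    fun x => ?_
  ring

/-- The relaxed output of an update of order `p` agrees with the extrapolated solution up to
`O(h^{p+1})`; this is the denominator expansion required at the next order. -/
theorem UpdateExpansion.val_sub_solution {D : RelaxedDenseOutput B V}
    (hD : D.UpdateExpansion p W) (hB : B.HasOrder u tn p) (h0 : u tn = u₀)
    (hW : Bornology.IsBounded W) :
    BigOPow W (p + 1) fun h γ =>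
      D.val h γ - (u (tn + h) + (γ - 1) • (u (tn + h) - u tn)) :=
  (IsBigO.add hD (hB.extrapolation_bigOPow h0 hW)).congr_left fun x => by module

theorem UpdateExpansion.relaxedOrder {D : RelaxedDenseOutput B V}
    (hD : D.UpdateExpansion p W) (hB : B.HasOrder u tn p) (hu : S.IsPosSolution tn T u₀ u)
    (hT : 0 < T) (hW : Bornology.IsBounded W) (hW1 : W ∈ 𝓝 (1 : ℝ)) (hp : 2 ≤ p) :
    D.RelaxedOrder u tn p := by
  intro γ hγ
  have hlim : Tendsto γ (𝓝[>] 0) (𝓝 1) := by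
    have h1 : (fun h => γ h - 1) =O[𝓝[>] (0 : ℝ)] fun h => h := by
      simpa using hγ.trans (step_pow_isBigO (show 1 ≤ p - 1 by omega))
    simpa using (h1.trans_tendsto tendsto_step_zero).add_const 1
  have h1 := (hD.val_sub_solution hB hu.1 hW).comp (hlim.eventually_mem hW1)
  have h2 : (fun h => (γ h - 1) * h ^ 2) =O[𝓝[>] (0 : ℝ)] fun h => h ^ (p + 1) :=
    (hγ.mul (isBigO_refl (fun h : ℝ => h ^ 2) _)).congr_right fun h => by
      rw [← pow_add]
      congr 1
      omega
  refine (h1.add ((hu.extrapolation_isBigO hT hlim).trans h2)).congr_left fun h => ?_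
  rw [hu.1]
  abel

/-- The bootstrap: if the relaxed output of each level provides the denominators of the next one,
the denominator expansion at the lowest level propagates to all levels. -/
theorem DenominatorExpansion.bootstrap {B : ℕ → MPRK S u₀}
    {D : ∀ q, RelaxedDenseOutput (B q) V} {m P : ℕ} (hm : 1 ≤ m)
    (hu : S.IsPosSolution tn T u₀ u) (hT : 0 < T) (h1V : (1 : ℝ) ∈ V)
    (hB : ∀ q, m ≤ q → q ≤ P → (B q).HasOrder u tn q)
    (hsucc : ∀ q, m ≤ q → q < P → ∀ᶠ h in 𝓝[>] (0 : ℝ), ∀ γ ∈ V,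
      (D (q + 1)).sigmaBar h γ = (D q).val h γ)
    (hD1 : (D m).DenominatorExpansion u tn m {1}) (hWV : W ⊆ V) (hW : Bornology.IsBounded W)
    (hD : (D m).DenominatorExpansion u tn m W) {q : ℕ} (hmq : m ≤ q) (hqP : q ≤ P) :
    (D q).DenominatorExpansion u tn q W ∧ (D q).WeightExpansion q W ∧
      (D q).UpdateExpansion q W := by
  -- The induction carries along the value `γ = 1`, which controls the weights of the step itself.
  have step : ∀ W' ⊆ V, Bornology.IsBounded W' → ∀ q, m ≤ q → q < P →
      (D q).UpdateExpansion q W' → (D (q + 1)).DenominatorExpansion u tn (q + 1) W' := by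
    intro W' hWV' hW' q hq hqP' hU
    refine IsBigO.congr' (hU.val_sub_solution (hB q hq hqP'.le) hu.1 hW') ?_ EventuallyEq.rfl
    refine eventually_prod_principal_iff.2 ?_
    filter_upwards [hsucc q hq hqP'] with h hh γ hγ
    rw [hh γ (hWV' hγ)]
  have h1V' : {(1 : ℝ)} ⊆ V := Set.singleton_subset_iff.2 h1V
  have hb1 : Bornology.IsBounded {(1 : ℝ)} := Bornology.isBounded_singleton
  have key : (D q).DenominatorExpansion u tn q {1} ∧ (D q).DenominatorExpansion u tn q W := by
    induction q, hmq using Nat.le_induction with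
    | base => exact ⟨hD1, hD⟩
    | succ q hq ih =>
      obtain ⟨i1, i2⟩ := ih (by omega)
      have hBq := hB q hq (by omega)
      exact ⟨step _ h1V' hb1 q hq (by omega) (i1.weightExpansion_and_updateExpansion i1
          (hm.trans hq) hu hT hBq h1V' hb1).2,
        step _ hWV hW q hq (by omega) (i2.weightExpansion_and_updateExpansion i1
          (hm.trans hq) hu hT hBq hWV hW).2⟩
  exact ⟨key.2, key.2.weightExpansion_and_updateExpansion key.1 (hm.trans hmq) hu hT
    (hB q hmq hqP) hWV hW⟩

end RelaxedDenseOutput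

theorem mainTheorem3 {d : ℕ} (S : PDRS d) (u₀ : Fin d → ℝ) (tn T : ℝ) (hT : 0 < T)
    (u : ℝ → Fin d → ℝ) (hu : S.IsPosSolution tn T u₀ u) (V : Set ℝ) (hV : V ∈ 𝓝 (1 : ℝ)) :
    -- a single scheme: for each `γ ∈ V`, and uniformly on bounded subsets of `V`
    (∀ (B : MPRK S u₀) (D : RelaxedDenseOutput B V) (p : ℕ), 1 ≤ p → B.HasOrder u tn p →
      (∀ γ ∈ V, D.DenominatorExpansion u tn p {γ}) →
        (∀ γ ∈ V, D.WeightExpansion p {γ} ∧ D.UpdateExpansion p {γ}) ∧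
        (∀ W ⊆ V, Bornology.IsBounded W → D.DenominatorExpansion u tn p W →
          D.WeightExpansion p W ∧ D.UpdateExpansion p W)) ∧
    -- the bootstrap: level `q + 1` uses the relaxed output of level `q` as denominators
    (∀ (B : ℕ → MPRK S u₀) (D : ∀ q, RelaxedDenseOutput (B q) V) (m P : ℕ), 1 ≤ m →
      (∀ q, m ≤ q → q ≤ P → (B q).HasOrder u tn q) →
      (∀ q, m ≤ q → q < P → ∀ᶠ h in 𝓝[>] (0 : ℝ), ∀ γ ∈ V,
        (D (q + 1)).sigmaBar h γ = (D q).val h γ) →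
      (∀ γ ∈ V, (D m).DenominatorExpansion u tn m {γ}) →
        ∀ q, m ≤ q → q ≤ P →
          (∀ γ ∈ V, (D q).DenominatorExpansion u tn q {γ} ∧
            (D q).WeightExpansion q {γ} ∧ (D q).UpdateExpansion q {γ}) ∧
          (∀ W ⊆ V, Bornology.IsBounded W → (D m).DenominatorExpansion u tn m W →
            (D q).DenominatorExpansion u tn q W ∧
            (D q).WeightExpansion q W ∧ (D q).UpdateExpansion q W ∧
            (W ∈ 𝓝 (1 : ℝ) → 2 ≤ q → (D q).RelaxedOrder u tn q))) := by
  have h1V : (1 : ℝ) ∈ V := mem_of_mem_nhds hV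
  refine ⟨fun B D p hp hB hD => ?_, fun B D m P hm hB hsucc hD q hmq hqP => ?_⟩
  · have main : ∀ W ⊆ V, Bornology.IsBounded W → D.DenominatorExpansion u tn p W →
        D.WeightExpansion p W ∧ D.UpdateExpansion p W := fun W hWV hW hDW =>
      hDW.weightExpansion_and_updateExpansion (hD 1 h1V) hp hu hT hB hWV hW
    exact ⟨fun γ hγ => main _ (Set.singleton_subset_iff.2 hγ) Bornology.isBounded_singleton
      (hD γ hγ), main⟩
  · refine ⟨fun γ hγ => ?_, fun W hWV hW hDW => ?_⟩
    · exact RelaxedDenseOutput.DenominatorExpansion.bootstrap hm hu hT h1V hB hsucc (hD 1 h1V)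
        (Set.singleton_subset_iff.2 hγ) Bornology.isBounded_singleton (hD γ hγ) hmq hqP
    · obtain ⟨h1, h2, h3⟩ := RelaxedDenseOutput.DenominatorExpansion.bootstrap hm hu hT h1V hB hsucc
        (hD 1 h1V) hWV hW hDW hmq hqP
      exact ⟨h1, h2, h3, fun hW1 hq => h3.relaxedOrder (hB q hmq hqP) hu hT hW hW1 hq⟩
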